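/- A bi-vincular pattern of length $k$ is a triple $p=(\sigma,X,Y)$, where $\sigma$ is a permutation of $[k]=\{1,\dots,k\}$ and $X,Y\subseteq\{0,1,\dots,k\}$. It occurs in a permutation $\pi=\pi_1\pi_2\cdots\pi_n$ of $[n]$ if there are positions $1\le i_1<\dots<i_k\le n$ such that, writing $j_1<\dots<j_k$ for the elements of $\{\pi_{i_1},\dots,\pi_{i_k}\}$ in increasing order and setting $i_0=j_0=0$, $i_{k+1}=j_{k+1}=n+1$, one has $\pi_{i_a}=j_{\sigma_a}$ for all $a\in[k]$, $i_{x+1}=i_x+1$ for all $x\in X$, and $j_{y+1}=j_y+1$ for all $y\in Y$. Otherwise $\pi$ avoids $p$. Let $n\ge 0$. The number of permutations of $[n]$ avoiding $(321,\{1\},\{1\})$ equals the number of upper triangular (square, of any size) $0$-$1$ matrices with exactly $n+1$ entries equal to $1$ and with no zero rows or columns. It also equals the number of permutations of $[n+1]$ avoiding both $(231,\{1\},\{1\})$ and $(21,\{1\},\{1\})$. -/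

import Mathlib

/-- A bi-vincular pattern `(σ, X, Y)` of length `k`: a permutation `σ` of `[k]` and two subsets
`X`, `Y` of `{0, 1, …, k}`. (Here `[k]` is modelled by `Fin k`, that is, shifted by one; the
elements of `X` and `Y` are not shifted.) -/
structure BivincularPattern (k : ℕ) where
  σ : Equiv.Perm (Fin k)
  X : Finset (Fin (k + 1))
  Y : Finset (Fin (k + 1))

/-- For `1 ≤ i₁, …, i_k ≤ n` (given as elements of `Fin n`, so with values shifted by one), the
sequence `i₀ = 0, i₁, …, i_k, i_{k+1} = n + 1`, with values in `{0, …, n + 1}`. -/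
def bordered {k n : ℕ} (i : Fin k → Fin n) : Fin (k + 2) → ℕ :=
  Fin.cons (α := fun _ => ℕ) 0
    (Fin.snoc (α := fun _ => ℕ) (fun a => (i a : ℕ) + 1) (n + 1))

/-- `p` occurs in `π`: there are positions `i₁ < ⋯ < i_k` such that, if `j₁ < ⋯ < j_k` are the
letters at these positions in increasing order, then the reduction of the subsequence is `σ` (the
letter at position `i_a` is `j_{σ_a}`), `i_{x+1} = i_x + 1` for all `x ∈ X`, and
`j_{y+1} = j_y + 1` for all `y ∈ Y`, where `i₀ = j₀ = 0` and `i_{k+1} = j_{k+1} = n + 1`. -/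
def BivincularPattern.OccursIn {k n : ℕ} (p : BivincularPattern k)
    (π : Equiv.Perm (Fin n)) : Prop :=
  ∃ i j : Fin k → Fin n, StrictMono i ∧ StrictMono j ∧
    (∀ a, π (i a) = j (p.σ a)) ∧
    (∀ x ∈ p.X, bordered i x.succ = bordered i x.castSucc + 1) ∧
    (∀ y ∈ p.Y, bordered j y.succ = bordered j y.castSucc + 1)

/-- `π` avoids `p`. -/
def BivincularPattern.Avoids {k n : ℕ} (p : BivincularPattern k)
    (π : Equiv.Perm (Fin n)) : Prop :=
  ¬ p.OccursIn π

/-- The pattern `(321, {1}, {1})`. -/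
def pattern321 : BivincularPattern 3 where
  σ := ⟨![2, 1, 0], ![2, 1, 0], by decide, by decide⟩
  X := {1}
  Y := {1}

/-- The pattern `(231, {1}, {1})`. -/
def pattern231 : BivincularPattern 3 where
  σ := ⟨![1, 2, 0], ![2, 0, 1], by decide, by decide⟩
  X := {1}
  Y := {1}

/-- The pattern `(21, {1}, {1})`. -/
def pattern21 : BivincularPattern 2 where
  σ := ⟨![1, 0], ![1, 0], by decide, by decide⟩
  X := {1}
  Y := {1}

/-- `M` is an upper triangular binary (that is, 0-1) matrix with exactly `m` ones and without zero
rows or columns. -/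
structure IsUpperTriangularBinary (m : ℕ) {d : ℕ} (M : Matrix (Fin d) (Fin d) ℕ) : Prop where
  binary : ∀ r c, M r c = 0 ∨ M r c = 1
  upper : ∀ r c, c < r → M r c = 0
  row_ne_zero : ∀ r, ∃ c, M r c ≠ 0
  col_ne_zero : ∀ c, ∃ r, M r c ≠ 0
  ones : Nat.card {rc : Fin d × Fin d // M rc.1 rc.2 = 1} = m

/-! All three families grow by the same labelled generating tree, and such a tree is determined
level by level by its labels (`IsPrimitiveTree.exists_equiv`), so corresponding levels are
equinumerous.

For permutations a child arises by inserting a new largest letter. Call a letter good if it is the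
smallest or its predecessor stands to its left (`PredLeft`). Avoiding (321,{1},{1}) means that every
descent bottom is good, so the new letter may go just before a good letter or at the end. Avoiding
(231,{1},{1}) means that every ascent bottom is good, so the new letter may go first or just after a
good letter; (21,{1},{1}) then only forbids the site just before the old maximum. The label s counts
the children, and c locates the maximum among the good letters.

For matrices, s is the size and c the row of the topmost one in the last column. A child either
gains a one in the last column at a row m < c, or, for m > c, gains a row and a column at index m:
the part of the last column above row m moves to the new column, and the new row has its only one in
the last column. In both cases m is the new c, and the parent is recovered by checking whether row m
has a second one (`exists_eq_insert`, `exists_eq_grow`). -/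

/-- A generating tree whose nodes carry labels `(s, c)`: the root has label `(1, 0)`, and a node
with label `(s, c)` has exactly one child for each `i ≤ s` with `i ≠ c`, whose label is
`(s + 1, i)` if `c < i` and `(s, i)` otherwise. -/
structure IsPrimitiveTree (X : ℕ → Type) (s c : ∀ n, X n → ℕ)
    (R : ∀ n, X n → X (n + 1) → Prop) : Prop where
  root : ∃ x : X 0, (∀ y, y = x) ∧ s 0 x = 1 ∧ c 0 x = 0
  parent : ∀ n y, ∃ x, R n x y
  parent_unique : ∀ n x x' y, R n x y → R n x' y → x = x'
  label_ne : ∀ n x y, R n x y → c (n + 1) y ≠ c n x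
  label_le : ∀ n x y, R n x y → c (n + 1) y ≤ s n x
  size : ∀ n x y, R n x y → s (n + 1) y = s n x + if c n x < c (n + 1) y then 1 else 0
  child : ∀ n x i, i ≠ c n x → i ≤ s n x → ∃ y, R n x y ∧ c (n + 1) y = i
  child_unique : ∀ n x y y', R n x y → R n x y' → c (n + 1) y = c (n + 1) y' → y = y'

/-! ### Uniqueness of the generating tree -/

namespace IsPrimitiveTree

variable {X : ℕ → Type} {s c : ∀ n, X n → ℕ} {R : ∀ n, X n → X (n + 1) → Prop}

theorem exists_equiv_children (h : IsPrimitiveTree X s c R) (n : ℕ) :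
    ∃ e : X (n + 1) ≃ {q : X n × ℕ // q.2 ≠ c n q.1 ∧ q.2 ≤ s n q.1},
      (∀ y, c (n + 1) y = (e y).1.2) ∧
      ∀ y, s (n + 1) y = s n (e y).1.1 + if c n (e y).1.1 < (e y).1.2 then 1 else 0 := by
  choose f hf using h.parent n
  refine ⟨Equiv.ofBijective
    (fun y => ⟨(f y, c (n + 1) y), h.label_ne _ _ _ (hf y), h.label_le _ _ _ (hf y)⟩) ⟨?_, ?_⟩,
    fun y => rfl, fun y => h.size _ _ _ (hf y)⟩
  · intro y y' hy
    simp only [Subtype.mk.injEq, Prod.mk.injEq] at hy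
    exact h.child_unique n (f y) y y' (hf y) (hy.1 ▸ hf y') hy.2
  · rintro ⟨⟨x, i⟩, h1, h2⟩
    obtain ⟨y, hy, hc⟩ := h.child n x i h1 h2
    refine ⟨y, ?_⟩
    simp only [Subtype.mk.injEq, Prod.mk.injEq]
    exact ⟨h.parent_unique _ _ _ _ (hf y) hy, hc⟩

variable {Y : ℕ → Type} {s' c' : ∀ n, Y n → ℕ} {R' : ∀ n, Y n → Y (n + 1) → Prop}

/-- The labels of a node prescribe the labels of its children, so the bijection has to preserve both
labels for the induction to go through. -/
theorem exists_equiv (h : IsPrimitiveTree X s c R) (h' : IsPrimitiveTree Y s' c' R') (n : ℕ) :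
    ∃ e : X n ≃ Y n, (∀ x, s' n (e x) = s n x) ∧ ∀ x, c' n (e x) = c n x := by
  induction n with
  | zero =>
    obtain ⟨x, hx, hs, hc⟩ := h.root
    obtain ⟨y, hy, hs', hc'⟩ := h'.root
    refine ⟨⟨fun _ => y, fun _ => x, fun z => (hx z).symm, fun z => (hy z).symm⟩, ?_, ?_⟩
    · intro z; rw [hx z, hs]; exact hs'
    · intro z; rw [hx z, hc]; exact hc'
  | succ n ih =>
    obtain ⟨e, hes, hec⟩ := ih
    obtain ⟨f, hfc, hfs⟩ := h.exists_equiv_children n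
    obtain ⟨g, hgc, hgs⟩ := h'.exists_equiv_children n
    let E : {q : X n × ℕ // q.2 ≠ c n q.1 ∧ q.2 ≤ s n q.1} ≃
        {q : Y n × ℕ // q.2 ≠ c' n q.1 ∧ q.2 ≤ s' n q.1} :=
      (e.prodCongr (Equiv.refl ℕ)).subtypeEquiv (by
        rintro ⟨x, i⟩
        simp [hes, hec])
    refine ⟨(f.trans E).trans g.symm, fun x => ?_, fun x => ?_⟩
    · rw [hgs, hfs]
      simp [E, hes, hec]
    · rw [hgc, hfc]
      simp [E]

theorem card_eq (h : IsPrimitiveTree X s c R) (h' : IsPrimitiveTree Y s' c' R') (n : ℕ) :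
    Nat.card (X n) = Nat.card (Y n) :=
  let ⟨e, _⟩ := h.exists_equiv h' n
  Nat.card_congr e

end IsPrimitiveTree

/-! ### Avoidance in terms of adjacent letters and predecessors -/

/-- The letter at position `k` is either the smallest one, or its predecessor is to its left. -/
def PredLeft {n : ℕ} (π : Equiv.Perm (Fin n)) (k : Fin n) : Prop :=
  ∀ l, (π l : ℕ) + 1 = π k → l < k

/-- An occurrence is an adjacent descent whose bottom has its predecessor further right; that
predecessor is automatically the smallest of the three letters. -/
theorem pattern321_avoids_iff {n : ℕ} (π : Equiv.Perm (Fin n)) :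
    pattern321.Avoids π ↔
      ∀ i j : Fin n, (j : ℕ) = i + 1 → π j < π i → PredLeft π j := by
  unfold BivincularPattern.Avoids BivincularPattern.OccursIn
  constructor
  · intro h i j hij hlt l hl
    by_contra hlj
    have hne : l ≠ j := by rintro rfl; omega
    refine h ⟨![i, j, l], ![π l, π j, π i], ?_, ?_, ?_, ?_, ?_⟩
    · refine Fin.strictMono_iff_lt_succ.2 fun a => ?_
      fin_cases a <;> simp <;> omega
    · refine Fin.strictMono_iff_lt_succ.2 fun a => ?_
      fin_cases a <;> simp <;> omega
    · intro a; fin_cases a <;> simp [pattern321]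
    · simp only [pattern321, Finset.mem_singleton, forall_eq]
      show (j : ℕ) + 1 = i + 1 + 1
      omega
    · simp only [pattern321, Finset.mem_singleton, forall_eq]
      show (π j : ℕ) + 1 = π l + 1 + 1
      omega
  · rintro h ⟨i, j, hi, hj, hπ, hX, hY⟩
    have h0 : π (i 0) = j 2 := hπ 0
    have h1 : π (i 1) = j 1 := hπ 1
    have h2 : π (i 2) = j 0 := hπ 2
    have hx : (i 1 : ℕ) + 1 = i 0 + 1 + 1 := hX 1 (by simp [pattern321])
    have hy : (j 1 : ℕ) + 1 = j 0 + 1 + 1 := hY 1 (by simp [pattern321])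
    have h3 : i 1 < i 2 := hi (by decide)
    have h4 : j 1 < j 2 := hj (by decide)
    have := h (i 0) (i 1) (by omega) (by rwa [h0, h1]) (i 2) (by rw [h1, h2]; omega)
    omega

theorem pattern231_avoids_iff {n : ℕ} (π : Equiv.Perm (Fin n)) :
    pattern231.Avoids π ↔
      ∀ i j : Fin n, (j : ℕ) = i + 1 → π i < π j → PredLeft π i := by
  unfold BivincularPattern.Avoids BivincularPattern.OccursIn
  constructor
  · intro h i j hij hlt l hl
    by_contra hlj
    have hne : l ≠ i := by rintro rfl; omega
    have hne' : l ≠ j := by rintro rfl; rw [Fin.lt_def] at hlt; omega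
    refine h ⟨![i, j, l], ![π l, π i, π j], ?_, ?_, ?_, ?_, ?_⟩
    · refine Fin.strictMono_iff_lt_succ.2 fun a => ?_
      fin_cases a <;> simp <;> omega
    · refine Fin.strictMono_iff_lt_succ.2 fun a => ?_
      fin_cases a <;> simp <;> omega
    · intro a; fin_cases a <;> simp [pattern231]
    · simp only [pattern231, Finset.mem_singleton, forall_eq]
      show (j : ℕ) + 1 = i + 1 + 1
      omega
    · simp only [pattern231, Finset.mem_singleton, forall_eq]
      show (π i : ℕ) + 1 = π l + 1 + 1
      omega
  · rintro h ⟨i, j, hi, hj, hπ, hX, hY⟩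
    have h0 : π (i 0) = j 1 := hπ 0
    have h1 : π (i 1) = j 2 := hπ 1
    have h2 : π (i 2) = j 0 := hπ 2
    have hx : (i 1 : ℕ) + 1 = i 0 + 1 + 1 := hX 1 (by simp [pattern231])
    have hy : (j 1 : ℕ) + 1 = j 0 + 1 + 1 := hY 1 (by simp [pattern231])
    have h3 : i 1 < i 2 := hi (by decide)
    have h4 : j 1 < j 2 := hj (by decide)
    have := h (i 0) (i 1) (by omega) (by rwa [h0, h1]) (i 2) (by rw [h0, h2]; omega)
    omega

theorem pattern21_avoids_iff {n : ℕ} (π : Equiv.Perm (Fin n)) :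
    pattern21.Avoids π ↔
      ∀ i j : Fin n, (j : ℕ) = i + 1 → (π i : ℕ) ≠ π j + 1 := by
  unfold BivincularPattern.Avoids BivincularPattern.OccursIn
  constructor
  · intro h i j hij hlt
    refine h ⟨![i, j], ![π j, π i], ?_, ?_, ?_, ?_, ?_⟩
    · refine Fin.strictMono_iff_lt_succ.2 fun a => ?_
      fin_cases a; simp; omega
    · refine Fin.strictMono_iff_lt_succ.2 fun a => ?_
      fin_cases a; simp; omega
    · intro a; fin_cases a <;> simp [pattern21]
    · simp only [pattern21, Finset.mem_singleton, forall_eq]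
      show (j : ℕ) + 1 = i + 1 + 1
      omega
    · simp only [pattern21, Finset.mem_singleton, forall_eq]
      show (π i : ℕ) + 1 = π j + 1 + 1
      omega
  · rintro h ⟨i, j, hi, hj, hπ, hX, hY⟩
    have h0 : π (i 0) = j 1 := hπ 0
    have h1 : π (i 1) = j 0 := hπ 1
    have hx : (i 1 : ℕ) + 1 = i 0 + 1 + 1 := hX 1 (by simp [pattern21])
    have hy : (j 1 : ℕ) + 1 = j 0 + 1 + 1 := hY 1 (by simp [pattern21])
    exact h (i 0) (i 1) (by omega) (by rw [h0, h1]; omega)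

/-! ### Insertion of a new largest letter -/

/-- Insert a new largest letter into `σ` at position `p`. -/
def insertMax {n : ℕ} (p : Fin (n + 1)) (σ : Equiv.Perm (Fin n)) : Equiv.Perm (Fin (n + 1)) :=
  ((finSuccEquiv' p).trans (Equiv.optionCongr σ)).trans (finSuccEquiv' (Fin.last n)).symm

section insertMax

variable {n : ℕ} (p : Fin (n + 1)) (σ : Equiv.Perm (Fin n))

@[simp]
theorem insertMax_self : insertMax p σ p = Fin.last n := by
  simp [insertMax]

@[simp]
theorem insertMax_succAbove (k : Fin n) : insertMax p σ (p.succAbove k) = (σ k).castSucc := by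
  simp [insertMax]

theorem insertMax_injective {p p' : Fin (n + 1)} {σ σ' : Equiv.Perm (Fin n)}
    (h : insertMax p σ = insertMax p' σ') : p = p' ∧ σ = σ' := by
  have hp : p = p' := by
    apply (insertMax p' σ').injective
    rw [insertMax_self, ← h, insertMax_self]
  subst hp
  refine ⟨rfl, Equiv.ext fun k => ?_⟩
  have := congrArg (fun τ => τ (p.succAbove k)) h
  simpa using this

theorem exists_eq_insertMax (π : Equiv.Perm (Fin (n + 1))) : ∃ p σ, π = insertMax p σ := by
  set p := π.symm (Fin.last n) with hp
  let e : Option (Fin n) ≃ Option (Fin n) :=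
    ((finSuccEquiv' p).symm.trans π).trans (finSuccEquiv' (Fin.last n))
  have he : e none = none := by simp [e, hp]
  refine ⟨p, Equiv.removeNone e, ?_⟩
  have h2 : Equiv.optionCongr (Equiv.removeNone e) = e := by
    ext x : 1
    cases x with
    | none => simp [he]
    | some x =>
      simp only [Equiv.optionCongr_apply, Option.map_some]
      refine Equiv.removeNone_some e (Option.ne_none_iff_exists'.1 fun hx => ?_)
      exact Option.some_ne_none x (e.injective (hx.trans he.symm))
  rw [insertMax, h2]
  ext x
  simp [e]

theorem val_succAbove (k : Fin n) :
    (p.succAbove k : ℕ) = if (k : ℕ) < p then (k : ℕ) else k + 1 := by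
  unfold Fin.succAbove
  simp only [Fin.lt_def, Fin.val_castSucc]
  split_ifs <;> rfl

/-- The new letter, being the largest, is nobody's predecessor, and old letters keep their relative
order. -/
theorem predLeft_insertMax_succAbove (k : Fin n) :
    PredLeft (insertMax p σ) (p.succAbove k) ↔ PredLeft σ k := by
  constructor
  · intro h l hl
    have := h (p.succAbove l) (by simpa using hl)
    simpa using this
  · intro h l hl
    rcases Fin.eq_self_or_eq_succAbove p l with rfl | ⟨l, rfl⟩
    · simp at hl; omega
    · simp at hl
      simpa using h l hl

theorem predLeft_insertMax_self :
    PredLeft (insertMax p σ) p ↔ ∀ l, (σ l : ℕ) + 1 = n → (l : ℕ) < p := by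
  constructor
  · intro h l hl
    have := h (p.succAbove l) (by simpa using hl)
    rw [Fin.lt_def, val_succAbove] at this
    split_ifs at this <;> omega
  · intro h l hl
    rcases Fin.eq_self_or_eq_succAbove p l with rfl | ⟨l, rfl⟩
    · simp at hl
    · simp at hl
      have := h l hl
      rw [Fin.lt_def, val_succAbove]
      split_ifs; omega

end insertMax

/-! ### Counting good positions -/

open scoped Classical in
theorem Nat.count_lt_count_iff_lt {P : ℕ → Prop} {q t : ℕ} (hq : P q) :
    Nat.count P q < Nat.count P t ↔ q < t := by
  refine ⟨fun h => Nat.lt_of_count_lt_count h, fun h => ?_⟩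
  have h1 : Nat.count P (q + 1) ≤ Nat.count P t := Nat.count_monotone P h
  rw [Nat.count_succ, if_pos hq] at h1
  omega

open scoped Classical in
theorem Nat.exists_count_eq {P : ℕ → Prop} {i m : ℕ} (h : i < Nat.count P m) :
    ∃ q, P q ∧ q < m ∧ Nat.count P q = i :=
  ⟨Nat.nth P i, Nat.nth_mem i fun hf => h.trans_le (Nat.count_le_card hf m),
    Nat.nth_lt_of_lt_count h, Nat.count_nth fun hf => h.trans_le (Nat.count_le_card hf m)⟩

section CountInsert

open scoped Classical

variable {P P' : ℕ → Prop} {p : ℕ}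

theorem Nat.count_of_insert_le (h : ∀ q < p, (P' q ↔ P q)) : Nat.count P' p = Nat.count P p := by
  induction p with
  | zero => simp
  | succ p ih =>
    rw [Nat.count_succ, Nat.count_succ, ih fun q hq => h q (by omega)]
    simp only [h p (by omega)]

/-- Here P' is P with one extra index inserted at p and the later ones shifted. -/
theorem Nat.count_of_insert (h : ∀ q < p, (P' q ↔ P q)) (h' : ∀ q, p ≤ q → (P' (q + 1) ↔ P q))
    {m : ℕ} (hm : p ≤ m) :
    Nat.count P' (m + 1) = Nat.count P m + if P' p then 1 else 0 := by
  induction m, hm using Nat.le_induction with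
  | base => rw [Nat.count_succ, Nat.count_of_insert_le h]
  | succ m hm ih =>
    rw [Nat.count_succ, ih, Nat.count_succ]
    simp only [h' m hm]
    omega

end CountInsert

/-! ### Admissible insertion sites -/

section Sites

variable {n : ℕ}

/-- Inserting a letter just before position `q` (or at the end) does not destroy the relative
position of a letter at `q` and its predecessor. -/
def PredLeftAt (σ : Equiv.Perm (Fin n)) (q : ℕ) : Prop :=
  ∀ k : Fin n, (k : ℕ) = q → PredLeft σ k

/-- The number of positions up to that of the largest letter. -/
noncomputable def topPos (σ : Equiv.Perm (Fin n)) : ℕ :=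
  sInf {p | ∀ l, (σ l : ℕ) + 1 = n → (l : ℕ) < p}

/-- For n = 0 the condition is vacuous and `topPos` is 0, so the insertion lemmas need no separate
empty case. -/
theorem topPos_le_iff {σ : Equiv.Perm (Fin n)} {p : ℕ} :
    topPos σ ≤ p ↔ ∀ l, (σ l : ℕ) + 1 = n → (l : ℕ) < p := by
  have hne : {p | ∀ l, (σ l : ℕ) + 1 = n → (l : ℕ) < p}.Nonempty := ⟨n, fun _ _ => Fin.is_lt _⟩
  constructor
  · intro h l hl
    exact (Nat.sInf_mem hne l hl).trans_le h
  · intro h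
    exact Nat.sInf_le h

theorem topPos_eq {σ : Equiv.Perm (Fin n)} {k : Fin n} (h : (σ k : ℕ) + 1 = n) :
    topPos σ = k + 1 := by
  refine le_antisymm (topPos_le_iff.2 fun l hl => ?_) (topPos_le_iff.1 le_rfl k h)
  have : l = k := σ.injective (Fin.ext (by omega))
  omega

theorem topPos_le (σ : Equiv.Perm (Fin n)) : topPos σ ≤ n :=
  topPos_le_iff.2 fun _ _ => Fin.is_lt _

theorem exists_topPos_eq (σ : Equiv.Perm (Fin (n + 1))) :
    ∃ k, σ k = Fin.last n ∧ topPos σ = k + 1 :=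
  ⟨σ.symm (Fin.last n), by simp, topPos_eq (by simp)⟩

theorem predLeftAt_of_le (σ : Equiv.Perm (Fin n)) {q : ℕ} (h : n ≤ q) : PredLeftAt σ q :=
  fun k hk => by omega

theorem predLeftAt_val {σ : Equiv.Perm (Fin n)} {k : Fin n} :
    PredLeftAt σ k ↔ PredLeft σ k :=
  ⟨fun h => h k rfl, fun h _ hl => Fin.ext hl ▸ h⟩

variable (p : Fin (n + 1)) (σ : Equiv.Perm (Fin n))

@[simp]
theorem topPos_insertMax : topPos (insertMax p σ) = p + 1 :=
  topPos_eq (by simp)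

theorem predLeftAt_insertMax_self : PredLeftAt (insertMax p σ) p ↔ topPos σ ≤ p := by
  rw [predLeftAt_val, predLeft_insertMax_self, topPos_le_iff]

theorem predLeftAt_insertMax_lt {q : ℕ} (hq : q < p) :
    PredLeftAt (insertMax p σ) q ↔ PredLeftAt σ q := by
  have hk : ((p.succAbove ⟨q, by omega⟩ : Fin (n + 1)) : ℕ) = q := by simp [val_succAbove, hq]
  conv_lhs => rw [← hk]
  rw [predLeftAt_val, predLeft_insertMax_succAbove, ← predLeftAt_val]

theorem predLeftAt_insertMax_succ {q : ℕ} (hq : p ≤ q) :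
    PredLeftAt (insertMax p σ) (q + 1) ↔ PredLeftAt σ q := by
  by_cases hn : q < n
  · have hk : ((p.succAbove ⟨q, hn⟩ : Fin (n + 1)) : ℕ) = q + 1 := by
      simp [val_succAbove]; omega
    conv_lhs => rw [← hk]
    rw [predLeftAt_val, predLeft_insertMax_succAbove, ← predLeftAt_val]
  · exact iff_of_true (predLeftAt_of_le _ (by omega)) (predLeftAt_of_le _ (by omega))

open scoped Classical in
theorem count_predLeftAt_insertMax_self :
    Nat.count (PredLeftAt (insertMax p σ)) p = Nat.count (PredLeftAt σ) p :=
  Nat.count_of_insert_le fun _ => predLeftAt_insertMax_lt p σ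

open scoped Classical in
theorem count_predLeftAt_insertMax {m : ℕ} (hm : p ≤ m) :
    Nat.count (PredLeftAt (insertMax p σ)) (m + 1) =
      Nat.count (PredLeftAt σ) m + if topPos σ ≤ p then 1 else 0 := by
  rw [Nat.count_of_insert (fun _ => predLeftAt_insertMax_lt p σ)
    (fun _ => predLeftAt_insertMax_succ p σ) hm]
  simp only [predLeftAt_insertMax_self]

/-- The only new descent bottom is the letter pushed right from p. A descent of σ broken by the
insertion has that same letter as its bottom, so no condition is lost. -/
theorem pattern321_avoids_insertMax :
    pattern321.Avoids (insertMax p σ) ↔ pattern321.Avoids σ ∧ PredLeftAt σ p := by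
  simp only [pattern321_avoids_iff]
  constructor
  · intro h
    have hp : PredLeftAt σ p := by
      intro k hk
      refine (predLeft_insertMax_succAbove p σ k).1 (h p _ ?_ ?_)
      · simp [val_succAbove, hk]
      · simp [Fin.castSucc_lt_last]
    refine ⟨fun i j hij hlt => ?_, hp⟩
    by_cases hj : (j : ℕ) = p
    · exact hp j hj
    · refine (predLeft_insertMax_succAbove p σ j).1 (h (p.succAbove i) _ ?_ (by simpa using hlt))
      simp only [val_succAbove]
      split_ifs <;> omega
  · rintro ⟨h, hp⟩ i j hij hlt
    rcases Fin.eq_self_or_eq_succAbove p j with rfl | ⟨j, rfl⟩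
    · rw [insertMax_self] at hlt
      exact absurd hlt (Fin.le_last _).not_gt
    · rw [predLeft_insertMax_succAbove]
      rcases Fin.eq_self_or_eq_succAbove p i with rfl | ⟨i, rfl⟩
      · refine hp j ?_
        rw [val_succAbove] at hij
        split_ifs at hij <;> omega
      · refine h i j ?_ (by simpa using hlt)
        simp only [val_succAbove] at hij
        split_ifs at hij <;> omega

/-- Mirror image of the previous case: the only new ascent bottom is the letter just before p. -/
theorem pattern231_avoids_insertMax :
    pattern231.Avoids (insertMax p σ) ↔
      pattern231.Avoids σ ∧ ∀ q, q + 1 = (p : ℕ) → PredLeftAt σ q := by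
  simp only [pattern231_avoids_iff]
  constructor
  · intro h
    have hp : ∀ q, q + 1 = (p : ℕ) → PredLeftAt σ q := by
      intro q hq k hk
      refine (predLeft_insertMax_succAbove p σ k).1 (h _ p ?_ ?_)
      · simp only [val_succAbove]
        split_ifs <;> omega
      · simp [Fin.castSucc_lt_last]
    refine ⟨fun i j hij hlt => ?_, hp⟩
    by_cases hi : (i : ℕ) + 1 = p
    · exact hp i hi i rfl
    · refine (predLeft_insertMax_succAbove p σ i).1 (h _ (p.succAbove j) ?_ (by simpa using hlt))
      simp only [val_succAbove]
      split_ifs <;> omega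
  · rintro ⟨h, hp⟩ i j hij hlt
    rcases Fin.eq_self_or_eq_succAbove p i with rfl | ⟨i, rfl⟩
    · rw [insertMax_self] at hlt
      exact absurd hlt (Fin.le_last _).not_gt
    · rw [predLeft_insertMax_succAbove]
      rcases Fin.eq_self_or_eq_succAbove p j with rfl | ⟨j, rfl⟩
      · refine hp i ?_ i rfl
        rw [val_succAbove] at hij
        split_ifs at hij <;> omega
      · refine h i j ?_ (by simpa using hlt)
        simp only [val_succAbove] at hij
        split_ifs at hij <;> omega

/-- The hypothesis prevents the insertion from repairing an occurrence in σ: a broken occurrence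
would have a top just before p with its predecessor on the right. -/
theorem pattern21_avoids_insertMax (hp : ∀ q, q + 1 = (p : ℕ) → PredLeftAt σ q) :
    pattern21.Avoids (insertMax p σ) ↔ pattern21.Avoids σ ∧ topPos σ ≠ p + 1 := by
  simp only [pattern21_avoids_iff]
  constructor
  · intro h
    refine ⟨fun i j hij he => ?_, fun ht => ?_⟩
    · by_cases hi : (i : ℕ) + 1 = p
      · have := hp i hi i rfl j he.symm
        omega
      · refine h (p.succAbove i) (p.succAbove j) ?_ (by simpa using he)
        simp only [val_succAbove]
        split_ifs <;> omega
    · obtain _ | n := n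
      · have := topPos_le σ
        omega
      · obtain ⟨k, hk, hk'⟩ := exists_topPos_eq σ
        refine h p (p.succAbove k) ?_ ?_
        · simp only [val_succAbove]
          split_ifs <;> omega
        · simp [hk]
  · rintro ⟨h, ht⟩ i j hij he
    rcases Fin.eq_self_or_eq_succAbove p j with rfl | ⟨j, rfl⟩
    · simp only [insertMax_self, Fin.val_last] at he
      omega
    · rcases Fin.eq_self_or_eq_succAbove p i with rfl | ⟨i, rfl⟩
      · simp only [insertMax_self, insertMax_succAbove, Fin.val_last, Fin.val_castSucc] at he
        rw [val_succAbove] at hij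
        have := topPos_eq he.symm
        split_ifs at hij <;> omega
      · refine h i j ?_ (by simpa using he)
        simp only [val_succAbove] at hij
        split_ifs at hij <;> omega

end Sites

/-! ### The tree of (321,{1},{1})-avoiders -/

open scoped Classical in
-- The extra 1 in s is the site at the end. Inserting at p gives the number of good positions below
-- p, plus 1 if p is right of the old maximum, since then the new letter is good. This shift makes
-- the labels skip exactly c.
theorem isPrimitiveTree_pattern321 :
    IsPrimitiveTree (fun n => {π : Equiv.Perm (Fin n) // pattern321.Avoids π})
      (fun n π => Nat.count (PredLeftAt π.1) n + 1)
      (fun _ π => Nat.count (PredLeftAt π.1) (topPos π.1))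
      (fun _ σ π => ∃ p, π.1 = insertMax p σ.1) where
  root := by
    refine ⟨⟨1, (pattern321_avoids_iff _).2 fun i => i.elim0⟩,
      fun y => Subsingleton.elim _ _, by simp, ?_⟩
    have := topPos_le (1 : Equiv.Perm (Fin 0))
    simp_all
  parent := by
    rintro n ⟨π, hπ⟩
    obtain ⟨p, σ, rfl⟩ := exists_eq_insertMax π
    exact ⟨⟨σ, ((pattern321_avoids_insertMax p σ).1 hπ).1⟩, p, rfl⟩
  parent_unique := by
    rintro n ⟨σ, hσ⟩ ⟨σ', hσ'⟩ ⟨π, hπ⟩ ⟨p, h⟩ ⟨p', h'⟩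
    exact Subtype.ext (insertMax_injective (h.symm.trans h')).2
  label_ne := by
    rintro n ⟨σ, hσ⟩ ⟨π, hπ⟩ ⟨p, rfl : π = _⟩
    have hp := ((pattern321_avoids_insertMax p σ).1 hπ).2
    have := Nat.count_lt_count_iff_lt (t := topPos σ) hp
    simp only [topPos_insertMax, count_predLeftAt_insertMax p σ le_rfl]
    split_ifs <;> omega
  label_le := by
    rintro n ⟨σ, hσ⟩ ⟨π, hπ⟩ ⟨p, rfl : π = _⟩
    have := Nat.count_monotone (PredLeftAt σ) (show (p : ℕ) ≤ n by omega)
    simp only [topPos_insertMax, count_predLeftAt_insertMax p σ le_rfl]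
    split_ifs <;> omega
  size := by
    rintro n ⟨σ, hσ⟩ ⟨π, hπ⟩ ⟨p, rfl : π = _⟩
    have hp := ((pattern321_avoids_insertMax p σ).1 hπ).2
    have := Nat.count_lt_count_iff_lt (t := topPos σ) hp
    simp only [topPos_insertMax, count_predLeftAt_insertMax p σ le_rfl,
      count_predLeftAt_insertMax p σ (show (p : ℕ) ≤ n by omega)]
    split_ifs <;> omega
  child := by
    rintro n ⟨σ, hσ⟩ i hne hle
    simp only at hne hle
    have hn : Nat.count (PredLeftAt σ) (n + 1) = Nat.count (PredLeftAt σ) n + 1 := by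
      rw [Nat.count_succ, if_pos (predLeftAt_of_le σ le_rfl)]
    have ht := Nat.count_monotone (PredLeftAt σ) (topPos_le σ)
    -- Labels below c are sites left of the maximum; those above c undo the shift by one. The bound
    -- n + 1 includes the end site.
    obtain ⟨q, hq, hqn, hqi⟩ := Nat.exists_count_eq (P := PredLeftAt σ) (m := n + 1)
      (i := if i < Nat.count (PredLeftAt σ) (topPos σ) then i else i - 1)
      (by split_ifs <;> omega)
    refine ⟨⟨insertMax ⟨q, hqn⟩ σ, (pattern321_avoids_insertMax _ σ).2 ⟨hσ, hq⟩⟩, ⟨_, rfl⟩, ?_⟩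
    have := Nat.count_lt_count_iff_lt (t := topPos σ) hq
    simp only [topPos_insertMax, count_predLeftAt_insertMax ⟨q, hqn⟩ σ le_rfl]
    split_ifs at * <;> omega
  child_unique := by
    rintro n ⟨σ, hσ⟩ ⟨π, hπ⟩ ⟨π', hπ'⟩ ⟨p, rfl : π = _⟩ ⟨p', rfl : π' = _⟩ h
    have hp := ((pattern321_avoids_insertMax p σ).1 hπ).2
    have hp' := ((pattern321_avoids_insertMax p' σ).1 hπ').2
    have h1 := Nat.count_lt_count_iff_lt (t := topPos σ) hp
    have h2 := Nat.count_lt_count_iff_lt (t := topPos σ) hp'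
    have h3 := Nat.count_lt_count_iff_lt (t := p') hp
    have h4 := Nat.count_lt_count_iff_lt (t := p) hp'
    simp only [topPos_insertMax, count_predLeftAt_insertMax _ σ le_rfl] at h
    have : p = p' := by
      apply Fin.ext
      split_ifs at h <;> omega
    subst this
    rfl

/-! ### The tree of permutations avoiding (231,{1},{1}) and (21,{1},{1}) -/

theorem predLeftAt_of_topPos_eq {n : ℕ} {σ : Equiv.Perm (Fin n)} (h : pattern231.Avoids σ)
    {q : ℕ} (hq : topPos σ = q + 2) : PredLeftAt σ q := by
  rw [pattern231_avoids_iff] at h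
  obtain _ | n := n
  · have := topPos_le σ
    omega
  · obtain ⟨k, hk, hk'⟩ := exists_topPos_eq σ
    intro i hi
    -- The letter just before the maximum is an ascent bottom, hence good.
    refine h i k (by omega) (hk ▸ Fin.lt_last_iff_ne_last.2 fun he => ?_)
    have := σ.injective (he.trans hk.symm)
    omega

open scoped Classical in
/-- The relative order of the numbers of good positions to the left of an admissible site and of
the largest letter. -/
theorem count_lt_count_topPos_iff {n : ℕ} {σ : Equiv.Perm (Fin (n + 1))}
    (h : pattern231.Avoids σ) {p : ℕ} (hp : ∀ q, q + 1 = p → PredLeftAt σ q)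
    (hne : topPos σ ≠ p + 1) :
    Nat.count (PredLeftAt σ) p ≠ Nat.count (PredLeftAt σ) (topPos σ - 1) ∧
      (Nat.count (PredLeftAt σ) (topPos σ - 1) < Nat.count (PredLeftAt σ) p ↔
        topPos σ ≤ p) := by
  obtain ⟨k, -, hk⟩ := exists_topPos_eq σ
  -- An admissible site b > 0 directly follows a good letter, so the count strictly increases on
  -- reaching b.
  have hsub : ∀ a b, (∀ q, q + 1 = b → PredLeftAt σ q) → a < b →
      Nat.count (PredLeftAt σ) a < Nat.count (PredLeftAt σ) b := by
    rintro a (_ | b) hb hab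
    · omega
    · have h1 := Nat.count_monotone (PredLeftAt σ) (show a ≤ b by omega)
      rw [Nat.count_succ, if_pos (hb b rfl)]
      omega
  rcases lt_or_ge p (k : ℕ) with hlt | hge
  · have := hsub p (topPos σ - 1) (fun q hq => predLeftAt_of_topPos_eq h (by omega)) (by omega)
    omega
  · have := hsub (topPos σ - 1) p hp (by omega)
    omega

open scoped Classical in
theorem isPrimitiveTree_pattern231_pattern21 :
    -- A site is named by the number of good letters to its left. The site just before the maximum
    -- has name c and is the one that (21,{1},{1}) excludes.
    IsPrimitiveTree
      (fun n => {π : Equiv.Perm (Fin (n + 1)) // pattern231.Avoids π ∧ pattern21.Avoids π})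
      (fun n π => Nat.count (PredLeftAt π.1) (n + 1))
      (fun _ π => Nat.count (PredLeftAt π.1) (topPos π.1 - 1))
      (fun _ σ π => ∃ p, π.1 = insertMax p σ.1) where
  root := by
    refine ⟨⟨1, (pattern231_avoids_iff _).2 fun i j _ _ => ?_,
      (pattern21_avoids_iff _).2 fun i j _ => ?_⟩, fun y => Subtype.ext (Subsingleton.elim (α := Equiv.Perm (Fin 1)) _ _), ?_, ?_⟩
    · omega
    · omega
    · rw [Nat.count_succ, if_pos]
      · simp
      · intro k hk l hl
        simp at hl
    · have := topPos_le (1 : Equiv.Perm (Fin (0 + 1)))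
      rw [Nat.sub_eq_zero_of_le (by omega), Nat.count_zero]
  parent := by
    rintro n ⟨π, hπ, hπ'⟩
    obtain ⟨p, σ, rfl⟩ := exists_eq_insertMax π
    obtain ⟨h1, h2⟩ := (pattern231_avoids_insertMax p σ).1 hπ
    exact ⟨⟨σ, h1, ((pattern21_avoids_insertMax p σ h2).1 hπ').1⟩, p, rfl⟩
  parent_unique := by
    rintro n ⟨σ, hσ⟩ ⟨σ', hσ'⟩ ⟨π, hπ⟩ ⟨p, h⟩ ⟨p', h'⟩
    exact Subtype.ext (insertMax_injective (h.symm.trans h')).2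
  label_ne := by
    rintro n ⟨σ, hσ⟩ ⟨π, hπ, hπ'⟩ ⟨p, rfl : π = _⟩
    obtain ⟨h1, h2⟩ := (pattern231_avoids_insertMax p σ).1 hπ
    have h3 := ((pattern21_avoids_insertMax p σ h2).1 hπ').2
    simpa only [topPos_insertMax, Nat.add_sub_cancel, count_predLeftAt_insertMax_self] using
      (count_lt_count_topPos_iff h1 h2 h3).1
  label_le := by
    rintro n ⟨σ, hσ⟩ ⟨π, hπ⟩ ⟨p, rfl : π = _⟩
    simpa only [topPos_insertMax, Nat.add_sub_cancel, count_predLeftAt_insertMax_self] using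
      Nat.count_monotone (PredLeftAt σ) (show (p : ℕ) ≤ n + 1 by omega)
  size := by
    rintro n ⟨σ, hσ⟩ ⟨π, hπ, hπ'⟩ ⟨p, rfl : π = _⟩
    obtain ⟨h1, h2⟩ := (pattern231_avoids_insertMax p σ).1 hπ
    have h3 := ((pattern21_avoids_insertMax p σ h2).1 hπ').2
    simp only [topPos_insertMax, Nat.add_sub_cancel, count_predLeftAt_insertMax_self,
      (count_lt_count_topPos_iff h1 h2 h3).2,
      count_predLeftAt_insertMax p σ (show (p : ℕ) ≤ n + 1 by omega)]
  child := by
    rintro n ⟨σ, hσ, hσ'⟩ i hne hle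
    simp only at hne hle
    obtain ⟨p, hp, hpn, rfl⟩ : ∃ p, (∀ q, q + 1 = p → PredLeftAt σ q) ∧ p < n + 2 ∧
        Nat.count (PredLeftAt σ) p = i := by
      obtain _ | i := i
      · exact ⟨0, by omega, by omega, by simp⟩
      · obtain ⟨q, hq, hqn, hqi⟩ := Nat.exists_count_eq hle
        refine ⟨q + 1, ?_, by omega, by rw [Nat.count_succ, if_pos hq, hqi]⟩
        rintro q' hq'
        obtain rfl : q' = q := by omega
        exact hq
    have ht : topPos σ ≠ p + 1 := fun ht => by simp [ht] at hne
    exact ⟨⟨insertMax ⟨p, hpn⟩ σ, (pattern231_avoids_insertMax _ σ).2 ⟨hσ, hp⟩,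
      (pattern21_avoids_insertMax _ σ hp).2 ⟨hσ', ht⟩⟩, ⟨_, rfl⟩, by
      simp only [topPos_insertMax, Nat.add_sub_cancel]
      exact count_predLeftAt_insertMax_self ⟨p, hpn⟩ σ⟩
  child_unique := by
    rintro n ⟨σ, hσ⟩ ⟨π, hπ, _⟩ ⟨π', hπ', _⟩ ⟨p, rfl : π = _⟩ ⟨p', rfl : π' = _⟩ h
    have hp := ((pattern231_avoids_insertMax p σ).1 hπ).2
    have hp' := ((pattern231_avoids_insertMax p' σ).1 hπ').2
    simp only [topPos_insertMax, Nat.add_sub_cancel, count_predLeftAt_insertMax_self] at h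
    -- An admissible site is the leftmost one with its count.
    have key : ∀ a b : ℕ, (∀ q, q + 1 = b → PredLeftAt σ q) →
        Nat.count (PredLeftAt σ) a = Nat.count (PredLeftAt σ) b → b ≤ a := by
      rintro a (_ | b) hb hab
      · omega
      · have := (Nat.count_lt_count_iff_lt (t := a) (hb b rfl)).1
          (by rw [hab, Nat.count_succ, if_pos (hb b rfl)]; omega)
        omega
    obtain rfl : p = p' := Fin.ext (le_antisymm (key _ _ hp h.symm) (key _ _ hp' h))
    rfl

/-! ### Growing and shrinking triangular supports -/

/-- The set `S` of positions of the ones of an upper triangular `0`-`1` matrix of size `e + 1`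
without zero rows or columns, whose topmost one in the last column is in row `c`. -/
structure IsTriangularSupport (e c : ℕ) (S : Finset (ℕ × ℕ)) : Prop where
  le : ∀ a b, (a, b) ∈ S → a ≤ b
  le_last : ∀ a b, (a, b) ∈ S → b ≤ e
  row : ∀ a ≤ e, ∃ b, (a, b) ∈ S
  col : ∀ b ≤ e, ∃ a, (a, b) ∈ S
  first_mem : (c, e) ∈ S
  first_le : ∀ a, (a, e) ∈ S → c ≤ a

/-- The new position of the entry at `z` when an empty row and column are inserted before index
`m`, and the part of the last column `e` above row `m` is moved to the new column. -/
def growPos (e m : ℕ) (z : ℕ × ℕ) : ℕ × ℕ :=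
  -- For m = e + 1 the new column is itself the last one, and nothing moves.
  if z.2 = e ∧ z.1 < m ∧ m ≤ e then (z.1, m)
  else (if z.1 < m then z.1 else z.1 + 1, if z.2 < m then z.2 else z.2 + 1)

/-- A left inverse of `growPos e m`. -/
def shrinkPos (e m : ℕ) (z : ℕ × ℕ) : ℕ × ℕ :=
  if z.2 = m then (z.1, e)
  else (if z.1 < m then z.1 else z.1 - 1, if z.2 < m then z.2 else z.2 - 1)

/-- Only entries moved out of the last column land in column m, so column m can be sent back to e.
-/
theorem shrinkPos_growPos {e m : ℕ} {z : ℕ × ℕ} : shrinkPos e m (growPos e m z) = z := by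
  obtain ⟨a, b⟩ := z
  unfold growPos shrinkPos
  ext <;> split_ifs <;> simp_all <;> omega

theorem growPos_fst_ne (e m : ℕ) (z : ℕ × ℕ) : (growPos e m z).1 ≠ m := by
  unfold growPos
  split_ifs <;> simp <;> omega

theorem exists_first {e a : ℕ} {S : Finset (ℕ × ℕ)} (h : (a, e) ∈ S) :
    ∃ c ≤ a, (c, e) ∈ S ∧ ∀ a, (a, e) ∈ S → c ≤ a := by
  classical
  have hex : ∃ c, (c, e) ∈ S := ⟨a, h⟩
  exact ⟨Nat.find hex, Nat.find_min' hex h, Nat.find_spec hex, fun _ => Nat.find_min' hex⟩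

namespace IsTriangularSupport

variable {e c c' m : ℕ} {S : Finset (ℕ × ℕ)}

theorem first_unique (h : IsTriangularSupport e c S) (h' : IsTriangularSupport e c' S) : c = c' :=
  le_antisymm (h.first_le _ h'.first_mem) (h'.first_le _ h.first_mem)

theorem first_le_last (h : IsTriangularSupport e c S) : c ≤ e := h.le _ _ h.first_mem

theorem notMem (h : IsTriangularSupport e c S) (hm : m < c) : (m, e) ∉ S :=
  fun hmem => absurd (h.first_le _ hmem) (by omega)

theorem insert_last (h : IsTriangularSupport e c S) (hm : m < c) :
    IsTriangularSupport e m (insert (m, e) S) := by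
  have hc := h.first_le_last
  constructor
  · intro a b hab
    rcases Finset.mem_insert.1 hab with hab | hab
    · simp only [Prod.mk.injEq] at hab
      omega
    · exact h.le a b hab
  · intro a b hab
    rcases Finset.mem_insert.1 hab with hab | hab
    · simp only [Prod.mk.injEq] at hab
      omega
    · exact h.le_last a b hab
  · intro a ha
    obtain ⟨b, hb⟩ := h.row a ha
    exact ⟨b, Finset.mem_insert_of_mem hb⟩
  · intro b hb
    obtain ⟨a, ha⟩ := h.col b hb
    exact ⟨a, Finset.mem_insert_of_mem ha⟩
  · exact Finset.mem_insert_self _ _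
  · intro a ha
    rcases Finset.mem_insert.1 ha with ha | ha
    · simp only [Prod.mk.injEq] at ha
      omega
    · have := h.first_le a ha
      omega

theorem exists_eq_insert (h : IsTriangularSupport e m S) {b : ℕ} (hb : (m, b) ∈ S) (hbe : b ≠ e) :
    ∃ c T, IsTriangularSupport e c T ∧ m < c ∧ S = insert (m, e) T := by
  have hmb := h.le _ _ hb
  have hb' := h.le_last _ _ hb
  -- As m ≤ b < e, this entry keeps the last column nonzero when (m, e) is erased; (m, b) does so
  -- for row m.
  have hee : (e, e) ∈ S := by
    obtain ⟨k, hk⟩ := h.row e le_rfl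
    obtain rfl : k = e := le_antisymm (h.le_last _ _ hk) (h.le _ _ hk)
    exact hk
  have hmem : ∀ x y, (x, y) ∈ S.erase (m, e) ↔ ¬(x = m ∧ y = e) ∧ (x, y) ∈ S := by
    intro x y
    rw [Finset.mem_erase, ne_eq, Prod.mk.injEq]
  obtain ⟨c, -, hc, hc'⟩ := exists_first ((hmem e e).2 ⟨by omega, hee⟩)
  refine ⟨c, S.erase (m, e), ⟨?_, ?_, ?_, ?_, hc, hc'⟩, ?_, ?_⟩
  · intro a b hab
    exact h.le _ _ ((hmem a b).1 hab).2
  · intro a b hab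
    exact h.le_last _ _ ((hmem a b).1 hab).2
  · intro a ha
    by_cases ham : a = m
    · exact ⟨b, (hmem _ _).2 ⟨by omega, ham ▸ hb⟩⟩
    · obtain ⟨k, hk⟩ := h.row a ha
      exact ⟨k, (hmem _ _).2 ⟨by omega, hk⟩⟩
  · intro k hk
    by_cases hke : k = e
    · exact ⟨c, hke ▸ hc⟩
    · obtain ⟨a, ha⟩ := h.col k hk
      exact ⟨a, (hmem _ _).2 ⟨by omega, ha⟩⟩
  · have h1 := (hmem _ _).1 hc
    have := h.first_le _ h1.2
    omega
  · rw [Finset.insert_erase h.first_mem]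

theorem notMem_grow : (m, e + 1) ∉ S.image (growPos e m) := by
  intro hmem
  obtain ⟨z, -, hz⟩ := Finset.mem_image.1 hmem
  exact growPos_fst_ne e m z (by rw [hz])

theorem eq_of_mem_grow {b : ℕ} (hb : (m, b) ∈ insert (m, e + 1) (S.image (growPos e m))) :
    b = e + 1 := by
  rcases Finset.mem_insert.1 hb with hb | hb
  · exact (Prod.mk.inj hb).2
  · obtain ⟨z, -, hz⟩ := Finset.mem_image.1 hb
    exact absurd (by rw [hz]) (growPos_fst_ne e m z)

/-- Since c < m, the topmost one of the last column moves into the new column when m ≤ e, which is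
therefore nonzero; the last column keeps only rows from m on. -/
theorem grow (h : IsTriangularSupport e c S) (hcm : c < m) (hm : m ≤ e + 1) :
    IsTriangularSupport (e + 1) m (insert (m, e + 1) (S.image (growPos e m))) := by
  have hgrow : ∀ a b, (a, b) ∈ S →
      growPos e m (a, b) ∈ insert (m, e + 1) (S.image (growPos e m)) := fun a b hab =>
    Finset.mem_insert_of_mem (Finset.mem_image_of_mem _ hab)
  have hcases : ∀ a b, (a, b) ∈ insert (m, e + 1) (S.image (growPos e m)) →
      (a = m ∧ b = e + 1) ∨ ∃ x y, (x, y) ∈ S ∧ growPos e m (x, y) = (a, b) := by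
    intro a b hab
    rcases Finset.mem_insert.1 hab with hab | hab
    · exact Or.inl (Prod.mk.inj hab)
    · obtain ⟨⟨x, y⟩, hxy, he⟩ := Finset.mem_image.1 hab
      exact Or.inr ⟨x, y, hxy, he⟩
  constructor
  · intro a b hab
    rcases hcases a b hab with hab | ⟨x, y, hxy, he⟩
    · omega
    · have h1 := h.le _ _ hxy
      unfold growPos at he
      split_ifs at he <;> simp only [Prod.mk.injEq] at he <;> omega
  · intro a b hab
    rcases hcases a b hab with hab | ⟨x, y, hxy, he⟩
    · omega
    · have h1 := h.le_last _ _ hxy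
      unfold growPos at he
      split_ifs at he <;> simp only [Prod.mk.injEq] at he <;> omega
  · intro a ha
    rcases lt_trichotomy a m with hlt | rfl | hgt
    · obtain ⟨b, hb⟩ := h.row a (by omega)
      refine ⟨(growPos e m (a, b)).2, ?_⟩
      convert hgrow a b hb using 1
      ext
      · unfold growPos; split_ifs <;> rfl
      · rfl
    · exact ⟨e + 1, Finset.mem_insert_self _ _⟩
    · obtain ⟨b, hb⟩ := h.row (a - 1) (by omega)
      refine ⟨(growPos e m (a - 1, b)).2, ?_⟩
      convert hgrow _ b hb using 1
      ext
      · unfold growPos; split_ifs <;> simp <;> omega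
      · rfl
  · intro b hb
    rcases eq_or_ne b (e + 1) with rfl | hbe
    · exact ⟨m, Finset.mem_insert_self _ _⟩
    · rcases lt_trichotomy b m with hlt | rfl | hgt
      · obtain ⟨a, ha⟩ := h.col b (by omega)
        refine ⟨(growPos e m (a, b)).1, ?_⟩
        convert hgrow a b ha using 1
        ext
        · rfl
        · unfold growPos; split_ifs <;> simp <;> omega
      · refine ⟨c, ?_⟩
        convert hgrow c e h.first_mem using 1
        rw [growPos, if_pos ⟨rfl, hcm, by omega⟩]
      · obtain ⟨a, ha⟩ := h.col (b - 1) (by omega)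
        refine ⟨(growPos e m (a, b - 1)).1, ?_⟩
        convert hgrow a _ ha using 1
        ext
        · rfl
        · unfold growPos; split_ifs <;> simp <;> omega
  · exact Finset.mem_insert_self _ _
  · intro a ha
    rcases hcases a _ ha with hab | ⟨x, y, hxy, he⟩
    · omega
    · have h1 := h.le_last _ _ hxy
      unfold growPos at he
      split_ifs at he <;> simp only [Prod.mk.injEq] at he <;> omega

/-- For m ≤ e, the ones of column m lie strictly above row m and those of the last column in row m
or below, so the two columns merge without collision once row m is deleted. -/
theorem exists_eq_grow (h : IsTriangularSupport (e + 1) m S)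
    (hrow : ∀ b, (m, b) ∈ S → b = e + 1) :
    ∃ c T, IsTriangularSupport e c T ∧ c < m ∧
      S = insert (m, e + 1) (T.image (growPos e m)) := by
  have hm := h.first_le_last
  have hT : ∀ a b, (a, b) ∈ S.erase (m, e + 1) ↔ a ≠ m ∧ (a, b) ∈ S := by
    intro a b
    rw [Finset.mem_erase, ne_eq, Prod.mk.injEq]
    constructor
    · rintro ⟨h1, h2⟩
      refine ⟨?_, h2⟩
      rintro rfl
      exact h1 ⟨rfl, hrow _ h2⟩
    · rintro ⟨h1, h2⟩
      exact ⟨fun h3 => h1 h3.1, h2⟩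
  have hsh : ∀ a b, a ≠ m → (a, b) ∈ S →
      shrinkPos e m (a, b) ∈ (S.erase (m, e + 1)).image (shrinkPos e m) := fun a b h1 h2 =>
    Finset.mem_image_of_mem _ ((hT a b).2 ⟨h1, h2⟩)
  have hcases : ∀ a b, (a, b) ∈ (S.erase (m, e + 1)).image (shrinkPos e m) →
      ∃ x y, x ≠ m ∧ (x, y) ∈ S ∧ shrinkPos e m (x, y) = (a, b) := by
    intro a b hab
    obtain ⟨⟨x, y⟩, hxy, he⟩ := Finset.mem_image.1 hab
    obtain ⟨h1, h2⟩ := (hT x y).1 hxy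
    exact ⟨x, y, h1, h2, he⟩
  -- The merged last column has a one above row m: from the old column e if m = e + 1, from column m
  -- otherwise.
  obtain ⟨k, hkm, hk⟩ : ∃ k < m, (k, e) ∈ (S.erase (m, e + 1)).image (shrinkPos e m) := by
    rcases Nat.lt_or_ge e m with hlt | hge
    · obtain ⟨a, ha⟩ := h.col e (by omega)
      have := h.le _ _ ha
      refine ⟨a, by omega, ?_⟩
      convert hsh a e (by omega) ha using 1
      unfold shrinkPos
      split_ifs <;> simp <;> omega
    · obtain ⟨a, ha⟩ := h.col m (by omega)
      have h1 := h.le _ _ ha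
      have h2 : a ≠ m := by
        rintro rfl
        have := hrow _ ha
        omega
      refine ⟨a, by omega, ?_⟩
      convert hsh a m h2 ha using 1
      simp [shrinkPos]
  obtain ⟨c, hck, hc, hc'⟩ := exists_first hk
  refine ⟨c, (S.erase (m, e + 1)).image (shrinkPos e m), ⟨?_, ?_, ?_, ?_, hc, hc'⟩, by omega, ?_⟩
  · intro a b hab
    obtain ⟨x, y, hx, hxy, he⟩ := hcases a b hab
    have h1 := h.le _ _ hxy
    unfold shrinkPos at he
    split_ifs at he <;> simp only [Prod.mk.injEq] at he <;> omega
  · intro a b hab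
    obtain ⟨x, y, hx, hxy, he⟩ := hcases a b hab
    have h1 := h.le_last _ _ hxy
    unfold shrinkPos at he
    split_ifs at he <;> simp only [Prod.mk.injEq] at he <;> omega
  · intro a ha
    rcases Nat.lt_or_ge a m with hlt | hge
    · obtain ⟨b, hb⟩ := h.row a (by omega)
      refine ⟨(shrinkPos e m (a, b)).2, ?_⟩
      convert hsh a b (by omega) hb using 1
      ext
      · unfold shrinkPos; split_ifs <;> simp
      · rfl
    · obtain ⟨b, hb⟩ := h.row (a + 1) (by omega)
      have := h.le _ _ hb
      refine ⟨(shrinkPos e m (a + 1, b)).2, ?_⟩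
      convert hsh (a + 1) b (by omega) hb using 1
      ext
      · unfold shrinkPos; split_ifs <;> simp <;> omega
      · rfl
  · intro b hb
    rcases eq_or_ne b e with rfl | hbe
    · exact ⟨k, hk⟩
    · rcases Nat.lt_or_ge b m with hlt | hge
      · obtain ⟨a, ha⟩ := h.col b (by omega)
        have := h.le _ _ ha
        refine ⟨(shrinkPos e m (a, b)).1, ?_⟩
        convert hsh a b (by omega) ha using 1
        ext
        · rfl
        · unfold shrinkPos; split_ifs <;> simp <;> omega
      · obtain ⟨a, ha⟩ := h.col (b + 1) (by omega)
        have h2 : a ≠ m := by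
          rintro rfl
          have := hrow _ ha
          omega
        refine ⟨(shrinkPos e m (a, b + 1)).1, ?_⟩
        convert hsh a (b + 1) h2 ha using 1
        ext
        · rfl
        · unfold shrinkPos; split_ifs <;> simp <;> omega
  · have hid : ∀ z ∈ S.erase (m, e + 1), growPos e m (shrinkPos e m z) = z := by
      rintro ⟨a, b⟩ hab
      obtain ⟨h1, h2⟩ := (hT a b).1 hab
      have h3 := h.le _ _ h2
      have h4 := h.le_last _ _ h2
      have h5 : b = e + 1 → m ≤ a := by
        rintro rfl
        exact h.first_le _ h2
      rcases eq_or_ne b m with rfl | hbm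
      · rw [shrinkPos, if_pos rfl, growPos, if_pos ⟨rfl, by simp only; omega, by omega⟩]
      · rw [shrinkPos, if_neg hbm, growPos, if_neg]
        · ext <;> simp only <;> split_ifs <;> omega
        · rintro ⟨h6, h7, h8⟩
          simp only at h6 h7
          split_ifs at h6 h7 <;> omega
    rw [Finset.image_image, Finset.image_congr (f := growPos e m ∘ shrinkPos e m) (g := id) hid, Finset.image_id,
      Finset.insert_erase h.first_mem]

end IsTriangularSupport

/-! ### The tree of triangular supports -/

/-- The child with label `m` of the triangular support `S` with label `(e + 1, c)`. -/
def supportChild (m : ℕ) (q : ℕ × ℕ × Finset (ℕ × ℕ)) : ℕ × ℕ × Finset (ℕ × ℕ) :=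
  if m < q.2.1 then (q.1, m, insert (m, q.1) q.2.2)
  else (q.1 + 1, m, insert (m, q.1 + 1) (q.2.2.image (growPos q.1 m)))

theorem supportChild_of_lt {m : ℕ} {q : ℕ × ℕ × Finset (ℕ × ℕ)} (h : m < q.2.1) :
    supportChild m q = (q.1, m, insert (m, q.1) q.2.2) := if_pos h

theorem supportChild_of_gt {m : ℕ} {q : ℕ × ℕ × Finset (ℕ × ℕ)} (h : q.2.1 < m) :
    supportChild m q =
      (q.1 + 1, m, insert (m, q.1 + 1) (q.2.2.image (growPos q.1 m))) := if_neg h.not_gt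

theorem card_supportChild {m : ℕ} {q : ℕ × ℕ × Finset (ℕ × ℕ)}
    (h : IsTriangularSupport q.1 q.2.1 q.2.2) :
    (supportChild m q).2.2.card = q.2.2.card + 1 := by
  unfold supportChild
  split_ifs with hm
  · exact Finset.card_insert_of_notMem (h.notMem hm)
  · rw [Finset.card_insert_of_notMem IsTriangularSupport.notMem_grow,
      Finset.card_image_of_injective _
        (Function.LeftInverse.injective fun _ => shrinkPos_growPos)]

/-- The triangular supports with `k` elements. -/
abbrev TriangularSupport (k : ℕ) : Type :=
  {q : ℕ × ℕ × Finset (ℕ × ℕ) // IsTriangularSupport q.1 q.2.1 q.2.2 ∧ q.2.2.card = k}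

theorem TriangularSupport.eq_of_child_eq {k m : ℕ} {q q' : TriangularSupport k}
    (hm : m ≠ q.1.2.1) (hm' : m ≠ q'.1.2.1)
    (he : supportChild m q.1 = supportChild m q'.1) : q = q' := by
  obtain ⟨⟨e, c, S⟩, h, _⟩ := q
  obtain ⟨⟨e', c', S'⟩, h', _⟩ := q'
  simp only at h h' hm hm'
  -- The two kinds of children differ: in the first, row m has a one outside the last column, in the
  -- second it has none.
  have key : ∀ {e c S e' c' S'}, IsTriangularSupport e c S → IsTriangularSupport e' c' S' →
      m < c → supportChild m (e, c, S) = supportChild m (e', c', S') → ¬ c' < m := by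
    intro e c S e' c' S' h h' hlt he hgt
    rw [supportChild_of_lt hlt, supportChild_of_gt hgt] at he
    simp only [Prod.mk.injEq, true_and] at he
    obtain ⟨b, hb⟩ := h.row m (hlt.le.trans h.first_le_last)
    have hb' := Finset.mem_insert_of_mem (b := (m, e)) hb
    rw [he.2] at hb'
    have := IsTriangularSupport.eq_of_mem_grow hb'
    have := h.le_last _ _ hb
    obtain rfl : b = e := by omega
    exact h.notMem hlt hb
  have fin : e = e' → S = S' → c = c' := by
    rintro rfl rfl
    exact h.first_unique h'
  suffices e = e' ∧ S = S' by
    obtain ⟨rfl, rfl⟩ := this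
    obtain rfl := fin rfl rfl
    rfl
  rcases lt_or_gt_of_ne hm with hlt | hgt <;> rcases lt_or_gt_of_ne hm' with hlt' | hgt'
  · rw [supportChild_of_lt hlt, supportChild_of_lt hlt'] at he
    simp only [Prod.mk.injEq, true_and] at he
    obtain ⟨rfl, he⟩ := he
    refine ⟨rfl, ?_⟩
    rw [← Finset.erase_insert (h.notMem hlt), he, Finset.erase_insert (h'.notMem hlt')]
  · exact absurd hgt' (key h h' hlt he)
  · exact absurd hgt (key h' h hlt' he.symm)
  · rw [supportChild_of_gt hgt, supportChild_of_gt hgt'] at he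
    simp only [Prod.mk.injEq, true_and, Nat.add_right_cancel_iff] at he
    obtain ⟨rfl, he⟩ := he
    refine ⟨rfl, ?_⟩
    have himg := congrArg (fun T => T.erase (m, e + 1)) he
    simp only [Finset.erase_insert IsTriangularSupport.notMem_grow] at himg
    exact Finset.image_injective
      (Function.LeftInverse.injective fun _ => shrinkPos_growPos) himg

theorem TriangularSupport.exists_eq_child {k : ℕ} (q : TriangularSupport (k + 2)) :
    ∃ p : TriangularSupport (k + 1), q.1.2.1 ≠ p.1.2.1 ∧ q.1.2.1 ≤ p.1.1 + 1 ∧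
      q.1 = supportChild q.1.2.1 p.1 := by
  obtain ⟨⟨e, m, S⟩, h, hk⟩ := q
  simp only at h hk ⊢
  have hme := h.first_le_last
  suffices ∃ p : ℕ × ℕ × Finset (ℕ × ℕ), IsTriangularSupport p.1 p.2.1 p.2.2 ∧ m ≠ p.2.1 ∧
      m ≤ p.1 + 1 ∧ (e, m, S) = supportChild m p by
    obtain ⟨p, hp, h1, h2, h3⟩ := this
    refine ⟨⟨p, hp, ?_⟩, h1, h2, h3⟩
    have := card_supportChild (m := m) hp
    rw [← h3] at this
    simp only at this
    omega
  by_cases hrow : ∃ b, (m, b) ∈ S ∧ b ≠ e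
  · obtain ⟨b, hb, hbe⟩ := hrow
    obtain ⟨c, T, hT, hmc, hST⟩ := h.exists_eq_insert hb hbe
    exact ⟨(e, c, T), hT, hmc.ne, by simp only; omega, by rw [supportChild_of_lt hmc, hST]⟩
  · push Not at hrow
    -- Size 1 allows a single one, whereas there are at least two.
    obtain _ | e := e
    · have hS : S ⊆ {(0, 0)} := by
        rintro ⟨a, b⟩ hab
        have h1 := h.le _ _ hab
        have h2 := h.le_last _ _ hab
        simp only [Finset.mem_singleton, Prod.mk.injEq]
        omega
      have := Finset.card_le_card hS
      simp only [Finset.card_singleton] at this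
      omega
    · obtain ⟨c, T, hT, hcm, hST⟩ := h.exists_eq_grow hrow
      exact ⟨(e, c, T), hT, hcm.ne', hme, by rw [supportChild_of_gt hcm, hST]⟩

theorem TriangularSupport.exists_child {k : ℕ} (p : TriangularSupport k) {m : ℕ}
    (hm : m ≠ p.1.2.1) (hle : m ≤ p.1.1 + 1) :
    ∃ q : TriangularSupport (k + 1), q.1.2.1 = m ∧ q.1 = supportChild q.1.2.1 p.1 := by
  obtain ⟨⟨e, c, S⟩, h, hk⟩ := p
  simp only at h hk hm hle ⊢
  have hc := card_supportChild (m := m) (q := (e, c, S)) h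
  rcases lt_or_gt_of_ne hm with hlt | hgt
  · rw [supportChild_of_lt hlt] at hc
    refine ⟨⟨(e, m, insert (m, e) S), h.insert_last hlt, by simpa [hk] using hc⟩, rfl, ?_⟩
    rw [supportChild_of_lt hlt]
  · rw [supportChild_of_gt hgt] at hc
    refine ⟨⟨(e + 1, m, insert (m, e + 1) (S.image (growPos e m))), h.grow hgt hle,
      by simpa [hk] using hc⟩, rfl, ?_⟩
    rw [supportChild_of_gt hgt]

theorem isPrimitiveTree_triangularSupport :
    IsPrimitiveTree (fun n => TriangularSupport (n + 1)) (fun _ q => q.1.1 + 1)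
      (fun _ q => q.1.2.1)
      (fun _ p q => q.1.2.1 ≠ p.1.2.1 ∧ q.1.2.1 ≤ p.1.1 + 1 ∧
        q.1 = supportChild q.1.2.1 p.1) where
  root := by
    have hS : IsTriangularSupport 0 0 {(0, 0)} := by
      constructor <;> simp
    refine ⟨⟨(0, 0, {(0, 0)}), hS, by simp⟩, ?_, rfl, rfl⟩
    rintro ⟨⟨e, c, S⟩, h, hk⟩
    simp only at h hk
    obtain ⟨x, rfl⟩ := Finset.card_eq_one.1 hk
    obtain ⟨a, ha⟩ := h.col 0 (by omega)
    have h0 := h.le _ _ ha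
    have h1 := h.first_mem
    rw [Finset.mem_singleton] at ha h1
    obtain rfl := ha.symm
    simp only [Prod.mk.injEq] at h1
    obtain ⟨rfl, rfl⟩ := h1
    obtain rfl : c = 0 := by omega
    rfl
  parent _ q := q.exists_eq_child
  parent_unique := by
    rintro n p p' q ⟨h1, h2, h3⟩ ⟨h1', h2', h3'⟩
    exact TriangularSupport.eq_of_child_eq h1 h1' (h3.symm.trans h3')
  label_ne _ _ _ h := h.1
  label_le _ _ _ h := h.2.1
  size := by
    rintro n p q ⟨h1, h2, h3⟩
    rcases lt_or_gt_of_ne h1 with hlt | hgt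
    · rw [supportChild_of_lt hlt] at h3
      rw [if_neg hlt.not_gt, congrArg Prod.fst h3]
    · rw [supportChild_of_gt hgt] at h3
      rw [if_pos hgt, congrArg Prod.fst h3]
  child n p i h1 h2 := by
    obtain ⟨q, rfl, hq⟩ := p.exists_child h1 h2
    exact ⟨q, ⟨h1, h2, hq⟩, rfl⟩
  child_unique := by
    rintro n p q q' ⟨-, -, h⟩ ⟨-, -, h'⟩ hc
    exact Subtype.ext (h.trans ((congrArg (supportChild · p.1) hc).trans h'.symm))

/-! ### From supports to matrices -/

/-- The positions of the ones of a matrix. -/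
def onesSupport {d : ℕ} (M : Matrix (Fin d) (Fin d) ℕ) : Finset (ℕ × ℕ) :=
  (Finset.univ.filter fun rc : Fin d × Fin d => M rc.1 rc.2 = 1).image
    (Prod.map Fin.val Fin.val)

section onesSupport

variable {d : ℕ} {M : Matrix (Fin d) (Fin d) ℕ}

theorem mem_onesSupport {a b : ℕ} :
    (a, b) ∈ onesSupport M ↔ ∃ r c : Fin d, M r c = 1 ∧ (r : ℕ) = a ∧ (c : ℕ) = b := by
  simp [onesSupport]

theorem card_onesSupport :
    (onesSupport M).card = Nat.card {rc : Fin d × Fin d // M rc.1 rc.2 = 1} := by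
  rw [onesSupport, Finset.card_image_of_injective _
    (Fin.val_injective.prodMap Fin.val_injective), Nat.card_eq_fintype_card, Fintype.card_subtype]

end onesSupport

/-- The `0`-`1` matrix of size `d` with given positions of the ones. -/
def matrixOfSupport (d : ℕ) (S : Finset (ℕ × ℕ)) : Matrix (Fin d) (Fin d) ℕ :=
  fun r c => if ((r : ℕ), (c : ℕ)) ∈ S then 1 else 0

theorem matrixOfSupport_eq_one {d : ℕ} {S : Finset (ℕ × ℕ)} {r c : Fin d} :
    matrixOfSupport d S r c = 1 ↔ ((r : ℕ), (c : ℕ)) ∈ S := by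
  simp [matrixOfSupport]

theorem matrixOfSupport_ne_zero {d : ℕ} {S : Finset (ℕ × ℕ)} {r c : Fin d} :
    matrixOfSupport d S r c ≠ 0 ↔ ((r : ℕ), (c : ℕ)) ∈ S := by
  simp [matrixOfSupport]

theorem IsTriangularSupport.onesSupport_matrixOfSupport {e c : ℕ} {S : Finset (ℕ × ℕ)}
    (h : IsTriangularSupport e c S) : onesSupport (matrixOfSupport (e + 1) S) = S := by
  ext ⟨a, b⟩
  simp only [mem_onesSupport, matrixOfSupport_eq_one]
  constructor
  · rintro ⟨r, c, h, rfl, rfl⟩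
    exact h
  · intro hab
    have h1 := h.le _ _ hab
    have h2 := h.le_last _ _ hab
    exact ⟨⟨a, by omega⟩, ⟨b, by omega⟩, hab, rfl, rfl⟩

theorem IsTriangularSupport.isUpperTriangularBinary {e c : ℕ} {S : Finset (ℕ × ℕ)}
    (h : IsTriangularSupport e c S) :
    IsUpperTriangularBinary S.card (matrixOfSupport (e + 1) S) where
  binary r c := by
    unfold matrixOfSupport
    split_ifs <;> simp
  upper r c hrc := by
    rw [matrixOfSupport, if_neg]
    intro hmem
    have := h.le _ _ hmem
    omega
  row_ne_zero r := by
    obtain ⟨b, hb⟩ := h.row r (by omega)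
    have := h.le_last _ _ hb
    exact ⟨⟨b, by omega⟩, matrixOfSupport_ne_zero.2 hb⟩
  col_ne_zero c := by
    obtain ⟨a, ha⟩ := h.col c (by omega)
    have := h.le _ _ ha
    exact ⟨⟨a, by omega⟩, matrixOfSupport_ne_zero.2 ha⟩
  ones := by
    rw [← card_onesSupport, h.onesSupport_matrixOfSupport]

namespace IsUpperTriangularBinary

variable {k d : ℕ}

theorem eq_one_of_ne_zero {M : Matrix (Fin d) (Fin d) ℕ} (h : IsUpperTriangularBinary k M)
    {r c : Fin d} (hrc : M r c ≠ 0) : M r c = 1 :=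
  (h.binary r c).resolve_left hrc

theorem matrixOfSupport_onesSupport {M : Matrix (Fin d) (Fin d) ℕ}
    (h : IsUpperTriangularBinary k M) : matrixOfSupport d (onesSupport M) = M := by
  ext r c
  have hiff : ((r : ℕ), (c : ℕ)) ∈ onesSupport M ↔ M r c = 1 := by
    rw [mem_onesSupport]
    constructor
    · rintro ⟨r', c', hM, hr, hc⟩
      rwa [Fin.ext hr, Fin.ext hc] at hM
    · exact fun hM => ⟨r, c, hM, rfl, rfl⟩
  rw [matrixOfSupport]
  rcases h.binary r c with h0 | h1
  · rw [if_neg (by rw [hiff, h0]; exact zero_ne_one), h0]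
  · rw [if_pos (hiff.2 h1), h1]

theorem exists_isTriangularSupport {e : ℕ} {M : Matrix (Fin (e + 1)) (Fin (e + 1)) ℕ}
    (h : IsUpperTriangularBinary k M) : ∃ c, IsTriangularSupport e c (onesSupport M) := by
  have hcol : ∀ b ≤ e, ∃ a, (a, b) ∈ onesSupport M := by
    intro b hb
    obtain ⟨r, hr⟩ := h.col_ne_zero ⟨b, by omega⟩
    exact ⟨r, mem_onesSupport.2 ⟨r, _, h.eq_one_of_ne_zero hr, rfl, rfl⟩⟩
  obtain ⟨a, ha⟩ := hcol e le_rfl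
  obtain ⟨c, -, hc, hc'⟩ := exists_first ha
  refine ⟨c, ?_, ?_, ?_, hcol, hc, hc'⟩
  · intro a b hab
    obtain ⟨r, c, hrc, rfl, rfl⟩ := mem_onesSupport.1 hab
    by_contra hlt
    rw [h.upper r c (by omega)] at hrc
    exact zero_ne_one hrc
  · intro a b hab
    obtain ⟨r, c, -, rfl, rfl⟩ := mem_onesSupport.1 hab
    omega
  · intro a ha
    obtain ⟨c, hc⟩ := h.row_ne_zero ⟨a, by omega⟩
    exact ⟨c, mem_onesSupport.2 ⟨_, c, h.eq_one_of_ne_zero hc, rfl, rfl⟩⟩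

end IsUpperTriangularBinary

theorem card_triangularSupport (n : ℕ) :
    Nat.card (TriangularSupport (n + 1)) =
      Nat.card {M : (d : ℕ) × Matrix (Fin d) (Fin d) ℕ // IsUpperTriangularBinary (n + 1) M.2} := by
  refine Nat.card_eq_of_bijective (fun q : TriangularSupport (n + 1) =>
    ⟨⟨q.1.1 + 1, matrixOfSupport (q.1.1 + 1) q.1.2.2⟩,
      by simpa only [q.2.2] using q.2.1.isUpperTriangularBinary⟩) ⟨?_, ?_⟩
  · rintro ⟨⟨e, c, S⟩, h, hk⟩ ⟨⟨e', c', S'⟩, h', hk'⟩ he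
    simp only [Subtype.mk.injEq, Sigma.mk.injEq, Nat.add_right_cancel_iff] at he h h' ⊢
    obtain ⟨rfl, he⟩ := he
    have hS : S = S' := by
      rw [← h.onesSupport_matrixOfSupport, ← h'.onesSupport_matrixOfSupport, eq_of_heq he]
    subst hS
    rw [h.first_unique h']
  · rintro ⟨⟨d, M⟩, h⟩
    obtain _ | e := d
    · have := h.ones
      simp at this
    · obtain ⟨c, hc⟩ := h.exists_isTriangularSupport
      refine ⟨⟨(e, c, onesSupport M), hc, card_onesSupport.trans h.ones⟩, ?_⟩
      simp only [Subtype.mk.injEq, Sigma.mk.injEq, heq_eq_eq, true_and]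
      exact h.matrixOfSupport_onesSupport

theorem mainTheorem2 (n : ℕ) :
    Nat.card {π : Equiv.Perm (Fin n) // pattern321.Avoids π} =
        Nat.card {M : (d : ℕ) × Matrix (Fin d) (Fin d) ℕ //
          IsUpperTriangularBinary (n + 1) M.2} ∧
      Nat.card {π : Equiv.Perm (Fin n) // pattern321.Avoids π} =
        Nat.card {π : Equiv.Perm (Fin (n + 1)) //
          pattern231.Avoids π ∧ pattern21.Avoids π} :=
  ⟨(isPrimitiveTree_pattern321.card_eq isPrimitiveTree_triangularSupport n).trans
      (card_triangularSupport n),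
    isPrimitiveTree_pattern321.card_eq isPrimitiveTree_pattern231_pattern21 n⟩
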